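/- Let $E$ be a category equipped with a Grothendieck topology. Let $\mathrm{Fib}(E)$ be the category whose objects are the categories fibred over $E$ (Grothendieck fibrations $F\to E$) and whose arrows are the cartesian functors, i.e. the functors over $E$ that send cartesian arrows to cartesian arrows. For $S\in E$ write $F_S$ for the fibre of $F$ over $S$ and, for $x,y\in F_S$, write $\mathrm{Hom}_S(x,y)$ for the presheaf on $E_{/S}$ that sends $g\colon T\to S$ to $F_T(g^*x,g^*y)$. A map $u\colon F\to G$ of $\mathrm{Fib}(E)$ is called * an *isofibration* if its underlying functor is one: for every object $a$ of $F$ and every isomorphism $i\colon u(a)\to b$ of $G$ there is an isomorphism $e\colon a\to a'$ of $F$ with $u(a')=b$ and $u(e)=i$; * *bicovering* if (i) it is locally bijective on arrows: for every $S\in E$ and $x,y\in F_S$ the map of presheaves $\mathrm{Hom}_S(x,y)\to \mathrm{Hom}_S(u(x),u(y))$ on $E_{/S}$ is locally injective and locally surjective; and (ii) it is locally essentially surjective on objects: for every $S\in E$ and $y\in G_S$ there is a covering sieve $R$ of $S$ such that for every $g\colon T\to S$ in $R$ there is $x\in F_T$ with $u(x)\cong g^*y$ in $G_T$. Then $\mathrm{Fib}(E)$,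 with the bicovering maps as weak equivalences and the isofibrations as fibrations, is a category of fibrant objects in the sense of Brown. That is: $\mathrm{Fib}(E)$ has finite products; every isomorphism is a weak equivalence, and if two of $f$, $g$, $gf$ are weak equivalences then so is the third; every isomorphism is a fibration and fibrations are closed under composition; the pullback of a fibration along any map exists and is a fibration, and it is a weak equivalence if the given fibration is one; every object $B$ has a path object, i.e. the diagonal $B\to B\times B$ is the composite of a weak equivalence followed by a fibration; and every map to the terminal object is a fibration. Moreover, bicovering maps are closed under pullback along isofibrations: if $u\colon F\to H$ is bicovering, $v\colon G\to H$ is an isofibration and the square formed by $P\to F$, $u'\colon P\to G$, $u$ and $v$ is a pullback square in $\mathrm{Fib}(E)$, then $u'$ is bicovering. -/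

import Mathlib

open CategoryTheory CategoryTheory.Limits

universe w v u

/-! ### Fibred categories over `E` and cartesian functors -/

/-- A fibred category over `E`: a category with a functor to `E` that is a Grothendieck fibration.
The objects live in a universe which is large enough for `E` itself, and the arrows of `E`,
to fit in; the arrows live in the universe of the arrows of `E`. -/
structure FibredCat (E : Type u) [Category.{v} E] where
  /-- the underlying category over `E` -/
  toBased : BasedCategory.{v, max u v w} E
  /-- the structure functor is a fibration -/
  isFibered : toBased.p.IsFibered

namespace FibredCat

variable {E : Type u} [Category.{v} E]

/-- The objects of the total category. -/
abbrev Obj (F : FibredCat.{w} E) : Type (max u v w) := F.toBased.obj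

/-- The structure functor to the base. -/
abbrev p (F : FibredCat.{w} E) : F.Obj ⥤ E := F.toBased.p

instance (F : FibredCat.{w} E) : F.p.IsFibered := F.isFibered

/-- A cartesian functor: a functor over `E` that sends cartesian arrows to cartesian arrows. -/
structure Hom (F G : FibredCat.{w} E) where
  /-- the underlying functor over `E` -/
  toBased : BasedFunctor F.toBased G.toBased
  /-- cartesian arrows are sent to cartesian arrows -/
  map_isCartesian : ∀ {R S : E} (f : R ⟶ S) {a b : F.Obj} (φ : a ⟶ b),
    F.p.IsCartesian f φ → G.p.IsCartesian f (toBased.map φ)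

/-- The category `Fib(E)` of fibred categories over `E` and cartesian functors. -/
instance : Category (FibredCat.{w} E) where
  Hom := Hom
  id F := ⟨BasedFunctor.id F.toBased, fun _ _ _ _ h => h⟩
  comp u v := ⟨u.toBased.comp v.toBased,
    fun f _ _ φ h => v.map_isCartesian f _ (u.map_isCartesian f φ h)⟩

/-- The underlying functor, between total categories, of a map of `Fib(E)`. -/
abbrev functor {F G : FibredCat.{w} E} (u : F ⟶ G) : F.Obj ⥤ G.Obj :=
  (Hom.toBased u).toFunctor

end FibredCat

/-! ### Isofibrations -/

/-- A functor is an isofibration if every isomorphism `P a ≅ b` lifts to an isomorphism with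
source `a`. -/
def IsIsofibration {A : Type*} {B : Type*} [Category A] [Category B] (P : A ⥤ B) : Prop :=
  ∀ (a : A) (b : B) (i : P.obj a ≅ b), ∃ (a' : A) (e : a ≅ a'), P.IsHomLift i.hom e.hom

namespace FibredCat

variable {E : Type u} [Category.{v} E]

/-- The maps of `Fib(E)` whose underlying functor is an isofibration. -/
def isofibrations (E : Type u) [Category.{v} E] : MorphismProperty (FibredCat.{w} E) :=
  fun _ _ u => IsIsofibration (functor u)

/-! ### Bicovering maps

For `x, y` in the fibre `F_S`, the presheaf `Hom_S(x, y)` on `E_{/S}` sends `g : T ⟶ S` to the set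
of arrows `g^*x ⟶ g^*y` of `F_T`, where `g^*x ⟶ x` and `g^*y ⟶ y` are cartesian arrows over `g`.
If `c : g^*x ⟶ x` and `d : g^*y ⟶ y` are such arrows, the restriction `g^*a` of `a : x ⟶ y` is the
unique arrow of `F_T` with `g^*a ≫ d = c ≫ a`; hence `g^*a = g^*b` if and only if
`c ≫ a = c ≫ b`. A section of `Hom_S(x, y)` over `g : T ⟶ S` is a section of `Hom_T(g^*x, g^*y)`
over `𝟙 T`, so that it is enough to speak about sections over identities, for all `S`, `x`, `y`. -/

/-- For all `S`, `x`, `y` the map of presheaves `Hom_S(x, y) ⟶ Hom_S(u x, u y)` is locally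
injective: two arrows `a, b : x ⟶ y` of `F_S` with `u a = u b` have equal restrictions along
the members of some covering sieve of `S`. -/
def LocallyInjectiveOnArrows (J : GrothendieckTopology E) {F G : FibredCat.{w} E} (u : F ⟶ G) :
    Prop :=
  ∀ ⦃S : E⦄ ⦃x y : F.Obj⦄ (a b : x ⟶ y), F.p.IsHomLift (𝟙 S) a → F.p.IsHomLift (𝟙 S) b →
    (functor u).map a = (functor u).map b →
    ∃ R ∈ J S, ∀ ⦃T : E⦄ (g : T ⟶ S), R g →
      ∀ ⦃x' : F.Obj⦄ (c : x' ⟶ x), F.p.IsCartesian g c → c ≫ a = c ≫ b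

/-- For all `S`, `x`, `y` the map of presheaves `Hom_S(x, y) ⟶ Hom_S(u x, u y)` is locally
surjective: for every arrow `β : u x ⟶ u y` of `G_S` there is a covering sieve of `S` such that the
restriction of `β` along each of its members is in the image of `u`. -/
def LocallySurjectiveOnArrows (J : GrothendieckTopology E) {F G : FibredCat.{w} E} (u : F ⟶ G) :
    Prop :=
  ∀ ⦃S : E⦄ ⦃x y : F.Obj⦄ (β : (functor u).obj x ⟶ (functor u).obj y), G.p.IsHomLift (𝟙 S) β →
    ∃ R ∈ J S, ∀ ⦃T : E⦄ (g : T ⟶ S), R g →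
      ∀ ⦃x' y' : F.Obj⦄ (c : x' ⟶ x) (d : y' ⟶ y), F.p.IsCartesian g c → F.p.IsCartesian g d →
        ∃ α : x' ⟶ y', F.p.IsHomLift (𝟙 T) α ∧
          (functor u).map α ≫ (functor u).map d = (functor u).map c ≫ β

/-- For every object `y` of `G_S` there is a covering sieve of `S` such that, for each of its
members `g : T ⟶ S`, the inverse image `g^*y` is isomorphic in `G_T` to `u x` for some object `x`
of `F_T`. -/
def LocallyEssSurjOnObjects (J : GrothendieckTopology E) {F G : FibredCat.{w} E} (u : F ⟶ G) :
    Prop :=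
  ∀ ⦃S : E⦄ (y : G.Obj), G.p.obj y = S →
    ∃ R ∈ J S, ∀ ⦃T : E⦄ (g : T ⟶ S), R g →
      ∀ ⦃y' : G.Obj⦄ (d : y' ⟶ y), G.p.IsCartesian g d →
        ∃ (x : F.Obj) (e : (functor u).obj x ≅ y'), G.p.IsHomLift (𝟙 T) e.hom

/-- The bicovering maps: the maps of `Fib(E)` that are locally bijective on arrows and locally
essentially surjective on objects. -/
def bicoverings (J : GrothendieckTopology E) : MorphismProperty (FibredCat.{w} E) :=
  fun _ _ u => (LocallyInjectiveOnArrows J u ∧ LocallySurjectiveOnArrows J u) ∧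
    LocallyEssSurjOnObjects J u

end FibredCat

/-! ### Categories of fibrant objects -/

/-- `C`, with the weak equivalences `W` and the fibrations `Fib`, is a category of fibrant objects
in the sense of Brown. -/
structure IsCategoryOfFibrantObjects {C : Type*} [Category C] (W Fib : MorphismProperty C) :
    Prop where
  /-- `C` has finite products (a terminal object included). -/
  [hasFiniteProducts : HasFiniteProducts C]
  /-- If two of `f`, `g`, `f ≫ g` are weak equivalences, so is the third. -/
  twoOutOfThree : W.HasTwoOutOfThreeProperty
  /-- Isomorphisms are weak equivalences. -/
  iso_weakEquivalence : ∀ ⦃X Y : C⦄ (f : X ⟶ Y), IsIso f → W f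
  /-- The composite of two fibrations is a fibration. -/
  comp_fibration : ∀ ⦃X Y Z : C⦄ (f : X ⟶ Y) (g : Y ⟶ Z), Fib f → Fib g → Fib (f ≫ g)
  /-- Isomorphisms are fibrations. -/
  iso_fibration : ∀ ⦃X Y : C⦄ (f : X ⟶ Y), IsIso f → Fib f
  /-- Pullbacks along fibrations exist. -/
  hasPullback : ∀ ⦃A B D : C⦄ (f : A ⟶ D) (g : B ⟶ D), Fib g → HasPullback f g
  /-- Fibrations are stable under pullback. -/
  pullback_fibration : ∀ ⦃P A B D : C⦄ ⦃p₁ : P ⟶ A⦄ ⦃p₂ : P ⟶ B⦄ ⦃f : A ⟶ D⦄ ⦃g : B ⟶ D⦄,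
    IsPullback p₁ p₂ f g → Fib g → Fib p₁
  /-- Trivial fibrations are stable under pullback. -/
  pullback_trivialFibration : ∀ ⦃P A B D : C⦄ ⦃p₁ : P ⟶ A⦄ ⦃p₂ : P ⟶ B⦄ ⦃f : A ⟶ D⦄ ⦃g : B ⟶ D⦄,
    IsPullback p₁ p₂ f g → Fib g → W g → Fib p₁ ∧ W p₁
  /-- Every object has a path object: the diagonal factors as a weak equivalence followed by a
  fibration. -/
  pathObject : ∀ B : C, ∃ (P : C) (s : B ⟶ P) (d : P ⟶ B ⨯ B), W s ∧ Fib d ∧ s ≫ d = diag B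
  /-- Every object is fibrant. -/
  fibrant : ∀ B : C, Fib (terminal.from B)

namespace FibredCat

variable {E : Type u} [Category.{v} E]

/-! A bicovering map is an equivalence "locally": faithful, full and essentially surjective after
restriction along cartesian arrows over a covering sieve. `Locally` makes this quantifier explicit.
It is monotone, commutes with conjunction, is transitive (`Locally.bind`) and moves along cartesian
functors, arrows and isomorphisms, so the usual proofs of two-out-of-three for equivalences carry
over with "exists" read as "exists locally". The delicate point is cancellation on the left factor:
an isomorphism between images under a bicovering map must be lifted locally. Fullness only lifts the
arrow; `bicoverings.locally_isCartesian_comp` recovers its invertibility.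

Pullbacks are strict fibre products of categories. Cartesian lifts in the two factors agree over the
base of the square only up to isomorphism, and the isofibration property corrects one of them
(`exists_isCartesian`). Arrows of the fibre product are pairs, so bicovering passes to both
projections. The terminal object is `E` itself and products are fibre products over it. The path
object of `B` is the category of vertical isomorphisms of `B`; constant paths form an equivalence,
and endpoints can be moved along isomorphisms by conjugation. -/

lemma isCartesian_map_of_isHomLift {A : Type*} [Category A] (p : A ⥤ E) {R S : E} {f : R ⟶ S}
    {a a' b : A} (φ : a ⟶ b) (ψ : a' ⟶ b) (hφ : p.IsHomLift f φ) (hψ : p.IsCartesian f ψ) :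
    p.IsCartesian (p.map φ) ψ := by
  cases hφ
  exact hψ

/-! ### Calculus of local truth along cartesian arrows. -/

section Locally

variable (J : GrothendieckTopology E)

/-- `P` holds for the cartesian arrows with target `x` over the members of a covering sieve
of `S`. -/
def Locally {F : FibredCat.{w} E} (S : E) (x : F.Obj) (P : ∀ ⦃x' : F.Obj⦄, (x' ⟶ x) → Prop) :
    Prop :=
  ∃ R ∈ J S, ∀ ⦃T : E⦄ (g : T ⟶ S), R g → ∀ ⦃x' : F.Obj⦄ (c : x' ⟶ x), F.p.IsCartesian g c → P c

variable {J} {F G H : FibredCat.{w} E} {S S' : E}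

lemma Locally.mono_of_isCartesian {x : F.Obj} {P Q : ∀ ⦃x' : F.Obj⦄, (x' ⟶ x) → Prop}
    (h : Locally J S x P)
    (k : ∀ ⦃T : E⦄ (g : T ⟶ S) ⦃x' : F.Obj⦄ (c : x' ⟶ x), F.p.IsCartesian g c → P c → Q c) :
    Locally J S x Q := by
  obtain ⟨R, hR, hP⟩ := h
  exact ⟨R, hR, fun T g hg x' c hc => k g c hc (hP g hg c hc)⟩

lemma Locally.mono {x : F.Obj} {P Q : ∀ ⦃x' : F.Obj⦄, (x' ⟶ x) → Prop}
    (h : Locally J S x P) (k : ∀ ⦃x' : F.Obj⦄ (c : x' ⟶ x), P c → Q c) : Locally J S x Q :=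
  h.mono_of_isCartesian fun _ _ _ c _ => k c

lemma Locally.and {x : F.Obj} {P Q : ∀ ⦃x' : F.Obj⦄, (x' ⟶ x) → Prop}
    (h : Locally J S x P) (k : Locally J S x Q) : Locally J S x (fun _ c => P c ∧ Q c) := by
  obtain ⟨R, hR, hP⟩ := h
  obtain ⟨R', hR', hQ⟩ := k
  exact ⟨R ⊓ R', J.intersection_covering hR hR', fun T g hg x' c hc =>
    ⟨hP g hg.1 c hc, hQ g hg.2 c hc⟩⟩

lemma Locally.of_forall {x : F.Obj} {P : ∀ ⦃x' : F.Obj⦄, (x' ⟶ x) → Prop}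
    (h : ∀ ⦃x' : F.Obj⦄ (c : x' ⟶ x), P c) : Locally J S x P :=
  ⟨⊤, J.top_mem S, fun _ _ _ _ c _ => h c⟩

/-- Being locally true is a local property. -/
lemma Locally.bind {x : F.Obj} {P Q : ∀ ⦃x' : F.Obj⦄, (x' ⟶ x) → Prop} (hx : F.p.obj x = S)
    (h : Locally J S x P)
    (k : ∀ ⦃T : E⦄ (g : T ⟶ S) ⦃x' : F.Obj⦄ (c : x' ⟶ x), F.p.IsCartesian g c → P c →
      Locally J T x' (fun _ d => Q (d ≫ c))) : Locally J S x Q := by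
  obtain ⟨R, hR, hP⟩ := h
  -- The sieve given by `k` depends on `c`, so one is chosen for the standard inverse image along
  -- each `g`. Any cartesian arrow over `f ≫ g` factors through that inverse image by a cartesian
  -- arrow over `f`.
  have k' : ∀ ⦃T : E⦄ ⦃g : T ⟶ S⦄ (_ : R g), Locally J T
      (Functor.IsPreFibered.pullbackObj hx g)
      (fun _ d => Q (d ≫ Functor.IsPreFibered.pullbackMap hx g)) :=
    fun T g hg => k g _ inferInstance (hP g hg _ inferInstance)
  choose R' hR' hQ using k'
  refine ⟨Sieve.bind R R', J.bind_covering hR fun T g hg => hR' hg, ?_⟩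
  rintro T _ ⟨Y, f, g, hg, hf, rfl⟩ x' e he
  let c := Functor.IsPreFibered.pullbackMap hx g
  let d := Functor.IsStronglyCartesian.map F.p g c (f' := f ≫ g) (g := f) rfl e
  have hd : d ≫ c = e := Functor.IsStronglyCartesian.fac F.p g c (f' := f ≫ g) (g := f) rfl e
  have : F.p.IsStronglyCartesian (f ≫ g) (d ≫ c) := by rw [hd]; infer_instance
  have : F.p.IsStronglyCartesian f d := Functor.IsStronglyCartesian.of_comp (g := g) (ψ := c) F.p
  rw [← hd]
  exact hQ hg f hf d inferInstance

/-- Restriction along a cartesian functor. -/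
lemma Locally.comap (u : F ⟶ G) {x : F.Obj}
    {Q : ∀ ⦃y : G.Obj⦄, (y ⟶ (functor u).obj x) → Prop}
    (h : Locally J S ((functor u).obj x) Q) :
    Locally J S x (fun _ c => Q ((functor u).map c)) := by
  obtain ⟨R, hR, hQ⟩ := h
  exact ⟨R, hR, fun T g hg x' c hc => hQ g hg _ (Hom.map_isCartesian u g c hc)⟩

/-- Inverse image along an arrow. -/
lemma Locally.pull (u : F ⟶ H) (v : G ⟶ H) {x : F.Obj} {y : G.Obj}
    (β : (functor u).obj x ⟶ (functor v).obj y) (hx : F.p.obj x = S) (hy : G.p.obj y = S')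
    {P : ∀ ⦃y' : G.Obj⦄, (y' ⟶ y) → Prop} (h : Locally J S' y P) :
    Locally J S x (fun _ c => ∃ (y' : G.Obj) (d : y' ⟶ y), P d ∧
      H.p.IsCartesian (H.p.map ((functor u).map c ≫ β)) ((functor v).map d)) := by
  obtain ⟨R, hR, hP⟩ := h
  have hx' : H.p.obj ((functor u).obj x) = S := (BasedFunctor.w_obj _ x).trans hx
  have hy' : H.p.obj ((functor v).obj y) = S' := (BasedFunctor.w_obj _ y).trans hy
  let f : S ⟶ S' := eqToHom hx'.symm ≫ H.p.map β ≫ eqToHom hy'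
  have hf : H.p.IsHomLift f β := IsHomLift.of_fac _ _ _ hx' hy' rfl
  -- For `g` in this sieve `g ≫ f` is in `R`, so `P` holds for the inverse image of `y` along `g ≫
  -- f`, which lies over the same base arrow as `u c ≫ β`.
  refine ⟨R.pullback f, J.pullback_stable f hR, fun T g hg x' c hc => ?_⟩
  refine ⟨_, Functor.IsPreFibered.pullbackMap hy (g ≫ f), hP (g ≫ f) hg _ inferInstance, ?_⟩
  have := Hom.map_isCartesian u g c hc
  exact isCartesian_map_of_isHomLift H.p (f := g ≫ f) _ _ inferInstance
    (Hom.map_isCartesian v _ _ inferInstance)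

/-- Transport along an isomorphism. -/
lemma Locally.transport (u : F ⟶ G) {x : F.Obj} {y : G.Obj} (e : (functor u).obj x ≅ y)
    (hx : F.p.obj x = S) (hy : G.p.obj y = S') {P : ∀ ⦃x' : F.Obj⦄, (x' ⟶ x) → Prop}
    (h : Locally J S x P) :
    Locally J S' y (fun y' d => ∃ (x' : F.Obj) (c : x' ⟶ x) (e' : (functor u).obj x' ≅ y'),
      P c ∧ e'.hom ≫ d = (functor u).map c ≫ e.hom) := by
  -- Pulling back along `e.inv` gives `u c` and `d ≫ e.inv`, both cartesian over one base arrow;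
  -- their comparison isomorphism is `e'`.
  refine (h.pull (𝟙 G) u (x := y) e.inv hy hx).mono_of_isCartesian ?_
  rintro T g y' d hd ⟨x', c, hc, hc'⟩
  change G.p.IsCartesian (G.p.map (d ≫ e.inv)) _ at hc'
  have : G.p.IsCartesian (G.p.map d) d := isCartesian_map_of_isHomLift _ _ _ inferInstance hd
  have : G.p.IsCartesian (G.p.map (d ≫ e.inv)) (d ≫ e.inv) := by
    rw [Functor.map_comp]; infer_instance
  let i := Functor.IsCartesian.domainUniqueUpToIso G.p (G.p.map (d ≫ e.inv)) (d ≫ e.inv)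
    ((functor u).map c)
  refine ⟨x', c, i, hc, ?_⟩
  rw [← cancel_mono e.inv]
  simp [i]

end Locally

/-! ### Bicovering conditions freed from vertical arrows. -/

variable (J : GrothendieckTopology E) {F G H : FibredCat.{w} E}

lemma isHomLift_functor_map_iff (u : F ⟶ G) {R S : E} (f : R ⟶ S) {a b : F.Obj} (φ : a ⟶ b) :
    G.p.IsHomLift f ((functor u).map φ) ↔ F.p.IsHomLift f φ :=
  BasedFunctor.isHomLift_iff _ _ _

/-- Since `u` lies over `E`, equality of images forces equal base arrows. Both arrows then factor
through one cartesian arrow into `y`, and their vertical parts have equal images by uniqueness of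
factorization in `G`. -/
lemma locallyInjectiveOnArrows_iff (u : F ⟶ G) :
    LocallyInjectiveOnArrows J u ↔ ∀ ⦃S : E⦄ ⦃x y : F.Obj⦄ (a b : x ⟶ y), F.p.obj x = S →
      (functor u).map a = (functor u).map b → Locally J S x (fun _ c => c ≫ a = c ≫ b) := by
  refine ⟨?_, fun h S x y a b ha _ hab => h a b (IsHomLift.domain_eq F.p (𝟙 S) a) hab⟩
  rintro h S x y a b rfl hab
  have hb : F.p.IsHomLift (F.p.map a) b := by
    rw [← isHomLift_functor_map_iff u, ← hab, isHomLift_functor_map_iff u]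
    infer_instance
  let d := Functor.IsPreFibered.pullbackMap (p := F.p) (a := y) rfl (F.p.map a)
  let a' := Functor.IsCartesian.map F.p (F.p.map a) d a
  let b' := Functor.IsCartesian.map F.p (F.p.map a) d b
  have ha' : a' ≫ d = a := Functor.IsCartesian.fac _ _ _ _
  have hb' : b' ≫ d = b := Functor.IsCartesian.fac _ _ _ _
  have hla : F.p.IsHomLift (𝟙 (F.p.obj x)) a' := inferInstance
  have hlb : F.p.IsHomLift (𝟙 (F.p.obj x)) b' := inferInstance
  have hd := Hom.map_isCartesian u (F.p.map a) d inferInstance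
  have h₁ := (isHomLift_functor_map_iff u _ _).2 hla
  have h₂ := (isHomLift_functor_map_iff u _ _).2 hlb
  have key : Locally J (F.p.obj x) x (fun _ c => c ≫ a' = c ≫ b') := by
    refine h a' b' hla hlb ?_
    refine Functor.IsCartesian.ext G.p (F.p.map a) ((functor u).map d) _ _ ?_
    rw [← Functor.map_comp, ← Functor.map_comp, ha', hb', hab]
  refine key.mono fun x' c hc => ?_
  rw [← ha', ← hb', ← Category.assoc, hc, Category.assoc]

/-- An arbitrary `β` is a vertical arrow followed by the image of a cartesian arrow into `y`, so
lifting the vertical part suffices. Conversely a lift `γ` becomes vertical after factoring through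
`d`. -/
lemma locallySurjectiveOnArrows_iff (u : F ⟶ G) :
    LocallySurjectiveOnArrows J u ↔ ∀ ⦃S : E⦄ ⦃x y : F.Obj⦄
      (β : (functor u).obj x ⟶ (functor u).obj y), F.p.obj x = S →
      Locally J S x (fun x' c => ∃ γ : x' ⟶ y, (functor u).map γ = (functor u).map c ≫ β) := by
  constructor
  · rintro h S x y β rfl
    have hx : G.p.obj ((functor u).obj x) = F.p.obj x := BasedFunctor.w_obj _ x
    have hy : G.p.obj ((functor u).obj y) = F.p.obj y := BasedFunctor.w_obj _ y
    let f : F.p.obj x ⟶ F.p.obj y := eqToHom hx.symm ≫ G.p.map β ≫ eqToHom hy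
    have hf : G.p.IsHomLift f β := IsHomLift.of_fac _ _ _ hx hy rfl
    let d := Functor.IsPreFibered.pullbackMap (p := F.p) (a := y) rfl f
    have hd := Hom.map_isCartesian u f d inferInstance
    let β' := Functor.IsCartesian.map G.p f ((functor u).map d) β
    have hβ' : β' ≫ (functor u).map d = β := Functor.IsCartesian.fac _ _ _ _
    obtain ⟨R, hR, hP⟩ := h (S := F.p.obj x) β' inferInstance
    refine ⟨R, hR, fun T g hg x' c hc => ?_⟩
    let d' := Functor.IsPreFibered.pullbackMap (IsHomLift.domain_eq F.p f d) g
    obtain ⟨α, -, hα⟩ := hP g hg c d' hc inferInstance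
    refine ⟨α ≫ d' ≫ d, ?_⟩
    rw [← hβ', Functor.map_comp, Functor.map_comp, reassoc_of% hα]
  · intro h S x y β hβ
    have hx : F.p.obj x = S :=
      (BasedFunctor.w_obj _ x).symm.trans (IsHomLift.domain_eq G.p (𝟙 S) β)
    obtain ⟨R, hR, hP⟩ := h β hx
    refine ⟨R, hR, fun T g hg x' y' c d hc hd => ?_⟩
    obtain ⟨γ, hγ⟩ := hP g hg c hc
    have := Hom.map_isCartesian u g c hc
    have hl : F.p.IsHomLift g γ := by
      rw [← isHomLift_functor_map_iff u, hγ]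
      infer_instance
    refine ⟨Functor.IsCartesian.map F.p g d γ, inferInstance, ?_⟩
    rw [← Functor.map_comp, Functor.IsCartesian.fac, hγ]

/-- A non-vertical isomorphism is made vertical by replacing `x` with its inverse image along the
inverse base isomorphism: a cartesian arrow over an isomorphism is invertible. -/
lemma locallyEssSurjOnObjects_iff (u : F ⟶ G) :
    LocallyEssSurjOnObjects J u ↔ ∀ ⦃S : E⦄ (y : G.Obj), G.p.obj y = S →
      Locally J S y (fun y' _ => ∃ x : F.Obj, Nonempty ((functor u).obj x ≅ y')) := by
  constructor
  · intro h S y hy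
    obtain ⟨R, hR, hP⟩ := h y hy
    refine ⟨R, hR, fun T g hg y' d hd => ?_⟩
    obtain ⟨x, e, -⟩ := hP g hg d hd
    exact ⟨x, ⟨e⟩⟩
  · intro h S y hy
    obtain ⟨R, hR, hP⟩ := h y hy
    refine ⟨R, hR, fun T g hg y' d hd => ?_⟩
    obtain ⟨x, ⟨e⟩⟩ := hP g hg d hd
    have hT : G.p.obj y' = T := IsHomLift.domain_eq G.p g d
    subst hT
    let f : F.p.obj x ≅ G.p.obj y' :=
      eqToIso (BasedFunctor.w_obj (Hom.toBased u) x).symm ≪≫ G.p.mapIso e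
    have hf : G.p.IsHomLift f.hom e.hom :=
      IsHomLift.of_fac _ _ _ (BasedFunctor.w_obj (Hom.toBased u) x) rfl (by simp [f])
    let c := Functor.IsPreFibered.pullbackMap (p := F.p) (a := x) rfl f.inv
    have : IsIso c := Functor.IsStronglyCartesian.isIso_of_base_isIso F.p f.inv c
    have hc := (isHomLift_functor_map_iff u f.inv c).2 inferInstance
    refine ⟨_, (functor u).mapIso (asIso c) ≪≫ e, ?_⟩
    have := IsHomLift.comp G.p f.inv f.hom ((functor u).map c) e.hom
    simpa using this

/-- A map of `Fib(E)` whose underlying functor is an equivalence is bicovering. -/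
lemma bicoverings_of_isEquivalence (u : F ⟶ G) [(functor u).IsEquivalence] : bicoverings J u := by
  refine ⟨⟨(locallyInjectiveOnArrows_iff J u).2 ?_, (locallySurjectiveOnArrows_iff J u).2 ?_⟩,
    (locallyEssSurjOnObjects_iff J u).2 ?_⟩
  · intro S x y a b _ hab
    rw [(functor u).map_injective hab]
    exact .of_forall fun _ _ => rfl
  · intro S x y β _
    refine .of_forall fun x' c => (functor u).map_surjective _
  · intro S y _
    exact .of_forall fun y' c => ⟨_, ⟨(functor u).objObjPreimageIso y'⟩⟩

variable {J}

namespace bicoverings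

variable {u : F ⟶ G} {S : E}

lemma inj (h : bicoverings J u) {x y : F.Obj} (a b : x ⟶ y) (hx : F.p.obj x = S)
    (hab : (functor u).map a = (functor u).map b) : Locally J S x (fun _ c => c ≫ a = c ≫ b) :=
  (locallyInjectiveOnArrows_iff J u).1 h.1.1 a b hx hab

lemma surj (h : bicoverings J u) {x y : F.Obj} (β : (functor u).obj x ⟶ (functor u).obj y)
    (hx : F.p.obj x = S) :
    Locally J S x (fun x' c => ∃ γ : x' ⟶ y, (functor u).map γ = (functor u).map c ≫ β) :=
  (locallySurjectiveOnArrows_iff J u).1 h.1.2 β hx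

lemma essSurj (h : bicoverings J u) (y : G.Obj) (hy : G.p.obj y = S) :
    Locally J S y (fun y' _ => ∃ x : F.Obj, Nonempty ((functor u).obj x ≅ y')) :=
  (locallyEssSurjOnObjects_iff J u).1 h.2 y hy

end bicoverings

lemma bicoverings_mk {u : F ⟶ G}
    (inj : ∀ ⦃S : E⦄ ⦃x y : F.Obj⦄ (a b : x ⟶ y), F.p.obj x = S →
      (functor u).map a = (functor u).map b → Locally J S x (fun _ c => c ≫ a = c ≫ b))
    (surj : ∀ ⦃S : E⦄ ⦃x y : F.Obj⦄ (β : (functor u).obj x ⟶ (functor u).obj y), F.p.obj x = S →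
      Locally J S x (fun x' c => ∃ γ : x' ⟶ y, (functor u).map γ = (functor u).map c ≫ β))
    (ess : ∀ ⦃S : E⦄ (y : G.Obj), G.p.obj y = S →
      Locally J S y (fun y' _ => ∃ x : F.Obj, Nonempty ((functor u).obj x ≅ y'))) :
    bicoverings J u :=
  ⟨⟨(locallyInjectiveOnArrows_iff J u).2 inj, (locallySurjectiveOnArrows_iff J u).2 surj⟩,
    (locallyEssSurjOnObjects_iff J u).2 ess⟩

end FibredCat

/-! ### Local lifting of isomorphisms and two-out-of-three. -/

namespace FibredCat

variable {E : Type u} [Category.{v} E]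

lemma isCartesian_of_isHomLift {A : Type*} [Category A] (p : A ⥤ E) {R S : E} {f : R ⟶ S}
    {a a' b : A} (φ : a ⟶ b) (ψ : a' ⟶ b) (hφ : p.IsHomLift f φ)
    (hψ : p.IsCartesian (p.map φ) ψ) : p.IsCartesian f ψ := by
  cases hφ
  exact hψ

variable {J : GrothendieckTopology E} {F G H : FibredCat.{w} E} {S : E}

/-- A vertical arrow which becomes invertible under a bicovering map is locally invertible. -/
lemma bicoverings.locally_isCartesian_comp {u : F ⟶ G} (h : bicoverings J u) {b a : F.Obj}
    (β : b ⟶ a) [hβ : F.p.IsHomLift (𝟙 S) β] [IsIso ((functor u).map β)] :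
    Locally J S b (fun _ k => ∃ (T : E) (t : T ⟶ S), F.p.IsCartesian t (k ≫ β)) := by
  have hb : F.p.obj b = S := IsHomLift.domain_eq F.p (𝟙 S) β
  have ha : F.p.obj a = S := IsHomLift.codomain_eq F.p (𝟙 S) β
  have key : Locally J S a (fun a' c => ∃ δ : a' ⟶ b, δ ≫ β = c ∧
      (functor u).map δ = (functor u).map c ≫ inv ((functor u).map β)) := by
    refine (h.surj (inv ((functor u).map β)) ha).bind ha ?_
    rintro T g a' c hc ⟨δ, hδ⟩
    refine (h.inj (δ ≫ β) c (IsHomLift.domain_eq F.p g c) (by simp [hδ])).mono ?_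
    intro a'' d hd
    exact ⟨d ≫ δ, by simpa using hd, by simp [hδ]⟩
  refine (key.pull (𝟙 F) (𝟙 F) β hb ha).bind hb ?_
  rintro T g b' k hk ⟨a', c, ⟨δ, hδc, hδ⟩, hc⟩
  have hkβ : F.p.IsHomLift g (k ≫ β) := by simpa using IsHomLift.comp F.p g (𝟙 S) k β
  replace hc : F.p.IsCartesian g c := isCartesian_of_isHomLift F.p (k ≫ β) c hkβ hc
  let ε := Functor.IsCartesian.map F.p g c (k ≫ β)
  have hε : ε ≫ c = k ≫ β := Functor.IsCartesian.fac _ _ _ _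
  have hl : F.p.IsHomLift (𝟙 T) ε := inferInstance
  have hδg : F.p.IsHomLift g δ := by
    rw [← isHomLift_functor_map_iff u, hδ]
    have := (isHomLift_functor_map_iff u g c).2 inferInstance
    have := (isHomLift_functor_map_iff u _ β).2 hβ
    have := IsHomLift.lift_id_inv_isIso G.p S ((functor u).map β)
    simpa using IsHomLift.comp G.p g (𝟙 S) ((functor u).map c) (inv ((functor u).map β))
  -- Here `ε` is the restriction of `β` along `g`. A second use of faithfulness makes `δ` a local
  -- retraction as well.
  have hεδ : (functor u).map (ε ≫ δ) = (functor u).map k := by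
    rw [Functor.map_comp, hδ, ← Functor.map_comp_assoc, hε]
    simp
  refine (h.inj _ _ (IsHomLift.domain_eq F.p g k) hεδ).mono_of_isCartesian ?_
  intro T' g' b'' d hd hdk
  refine ⟨T', g' ≫ g, ?_⟩
  have hdε : F.p.IsHomLift g' (d ≫ ε) := by simpa using IsHomLift.comp F.p g' (𝟙 T) d ε
  -- Over `T'` the restrictions `ε₀` of `ε` and `δ₀` of `δ` are mutually inverse, so `(d ≫ k) ≫ β`
  -- is an isomorphism followed by a cartesian arrow.
  let c' := Functor.IsPreFibered.pullbackMap (IsHomLift.domain_eq F.p g c) g'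
  let ε₀ := Functor.IsCartesian.map F.p g' c' (d ≫ ε)
  have hε₀ : ε₀ ≫ c' = d ≫ ε := Functor.IsCartesian.fac _ _ _ _
  let δ₀ := Functor.IsCartesian.map F.p (g' ≫ g) (d ≫ k) (c' ≫ δ)
  have hδ₀ : δ₀ ≫ d ≫ k = c' ≫ δ := Functor.IsCartesian.fac _ _ _ _
  have h₁ : F.p.IsHomLift (𝟙 T') ε₀ := inferInstance
  have h₂ : F.p.IsHomLift (𝟙 T') δ₀ := inferInstance
  have h₃ : F.p.IsHomLift (𝟙 T') (ε₀ ≫ δ₀) := by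
    simpa using IsHomLift.comp F.p (𝟙 T') (𝟙 T') ε₀ δ₀
  have h₄ : F.p.IsHomLift (𝟙 T') (δ₀ ≫ ε₀) := by
    simpa using IsHomLift.comp F.p (𝟙 T') (𝟙 T') δ₀ ε₀
  have h₅ := IsHomLift.id (p := F.p) (IsHomLift.domain_eq F.p g' d)
  have h₆ := IsHomLift.id (p := F.p) (IsHomLift.domain_eq F.p g' c')
  have e₁ : ε₀ ≫ δ₀ = 𝟙 _ := by
    refine Functor.IsCartesian.ext F.p (g' ≫ g) (d ≫ k) _ _ ?_
    rw [Category.assoc, hδ₀, reassoc_of% hε₀, hdk, Category.id_comp]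
  have e₂ : δ₀ ≫ ε₀ = 𝟙 _ := by
    refine Functor.IsCartesian.ext F.p (g' ≫ g) (c' ≫ c) _ _ ?_
    rw [Category.assoc, reassoc_of% hε₀, hε, reassoc_of% hδ₀, hδc, Category.id_comp]
  have : IsIso ε₀ := ⟨δ₀, e₁, e₂⟩
  have hfac : (d ≫ k) ≫ β = ε₀ ≫ c' ≫ c := by
    rw [reassoc_of% hε₀, hε, Category.assoc]
  rw [hfac]
  have : F.p.IsStronglyCartesian (𝟙 T' ≫ g' ≫ g) (ε₀ ≫ c' ≫ c) := inferInstance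
  rw [Category.id_comp] at this
  infer_instance

/-- Isomorphisms between images under a bicovering map lift locally. -/
lemma bicoverings.locally_exists_isCartesian {u : F ⟶ G} (h : bicoverings J u) {a b : F.Obj}
    (e : (functor u).obj a ≅ (functor u).obj b) (hb : F.p.obj b = S) :
    Locally J S b (fun b' _ => ∃ (γ : b' ⟶ a) (T S' : E) (t : T ⟶ S'), F.p.IsCartesian t γ) := by
  refine (h.surj e.inv hb).bind hb ?_
  rintro T g b' k hk ⟨γ, hγ⟩
  have hT : F.p.obj b' = T := IsHomLift.domain_eq F.p g k
  subst hT
  let m := Functor.IsPreFibered.pullbackMap (p := F.p) (a := a) rfl (F.p.map γ)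
  let β := Functor.IsCartesian.map F.p (F.p.map γ) m γ
  have hβm : β ≫ m = γ := Functor.IsCartesian.fac _ _ _ _
  have hβ : F.p.IsHomLift (𝟙 (F.p.obj b')) β := inferInstance
  have hm := Hom.map_isCartesian u (F.p.map γ) m inferInstance
  -- The image of `γ` is a cartesian arrow followed by an isomorphism. Comparison with the cartesian
  -- `u m` shows that the image of the vertical part `β` is invertible.
  have hγ' : G.p.IsCartesian (F.p.map γ) ((functor u).map γ) := by
    have h₁ := Hom.map_isCartesian u g k hk
    have h₂ : G.p.IsCartesian (G.p.map ((functor u).map k)) ((functor u).map k) :=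
      isCartesian_map_of_isHomLift _ _ _ inferInstance h₁
    have h₃ : G.p.IsCartesian (G.p.map ((functor u).map γ)) ((functor u).map γ) := by
      rw [hγ, Functor.map_comp]
      infer_instance
    exact isCartesian_of_isHomLift _ _ _ ((isHomLift_functor_map_iff u _ _).2 inferInstance) h₃
  have hβu : IsIso ((functor u).map β) := by
    have hlift := (isHomLift_functor_map_iff u _ β).2 hβ
    have : (functor u).map β = (Functor.IsCartesian.domainUniqueUpToIso G.p (F.p.map γ)
        ((functor u).map m) ((functor u).map γ)).hom := by
      refine Functor.IsCartesian.map_uniq G.p (F.p.map γ) _ _ _ ?_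
      rw [← Functor.map_comp, hβm]
    rw [this]
    infer_instance
  refine (h.locally_isCartesian_comp (S := F.p.obj b') β).mono ?_
  rintro b'' d ⟨T, t, hd⟩
  refine ⟨d ≫ γ, _, _, t ≫ F.p.map γ, ?_⟩
  rw [← hβm, ← Category.assoc]
  have : F.p.IsCartesian (t ≫ F.p.map γ) ((d ≫ β) ≫ m) := inferInstance
  simpa only [hβm] using this

lemma bicoverings.comp {f : F ⟶ G} {g : G ⟶ H} (hf : bicoverings J f) (hg : bicoverings J g) :
    bicoverings J (f ≫ g) := by
  refine bicoverings_mk ?_ ?_ ?_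
  · intro S x y a b hx hab
    refine ((hg.inj ((functor f).map a) ((functor f).map b)
      ((BasedFunctor.w_obj _ x).trans hx) hab).comap f).bind hx ?_
    intro T t x' c hc hcab
    rw [← Functor.map_comp, ← Functor.map_comp] at hcab
    simpa only [Category.assoc] using hf.inj _ _ (IsHomLift.domain_eq F.p t c) hcab
  · intro S x y β hx
    change (functor g).obj ((functor f).obj x) ⟶ (functor g).obj ((functor f).obj y) at β
    refine ((hg.surj (x := (functor f).obj x) (y := (functor f).obj y) β
      ((BasedFunctor.w_obj _ x).trans hx)).comap f).bind hx ?_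
    rintro T t x' c hc ⟨γ, hγ⟩
    refine (hf.surj γ (IsHomLift.domain_eq F.p t c)).mono ?_
    rintro x'' d ⟨δ, hδ⟩
    refine ⟨δ, ?_⟩
    change (functor g).map ((functor f).map δ) = (functor g).map ((functor f).map (d ≫ c)) ≫ β
    rw [hδ, Functor.map_comp, hγ, Functor.map_comp, Functor.map_comp, Category.assoc]
  · intro S z hz
    refine (hg.essSurj z hz).bind hz ?_
    rintro T t z' d hd ⟨y, ⟨e⟩⟩
    refine ((hf.essSurj y rfl).transport g e rfl (IsHomLift.domain_eq H.p t d)).mono ?_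
    rintro z'' d' ⟨y', c, e', ⟨x, ⟨i⟩⟩, -⟩
    exact ⟨x, ⟨(functor g).mapIso i ≪≫ e'⟩⟩

lemma bicoverings.of_comp_right {f : F ⟶ G} {g : G ⟶ H} (hg : bicoverings J g)
    (hfg : bicoverings J (f ≫ g)) : bicoverings J f := by
  refine bicoverings_mk ?_ ?_ ?_
  · intro S x y a b hx hab
    exact hfg.inj a b hx (congrArg (functor g).map hab)
  · intro S x y β hx
    refine (hfg.surj (x := x) (y := y) ((functor g).map β) hx).bind hx ?_
    rintro T t x' c hc ⟨γ, hγ⟩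
    have hx' : F.p.obj x' = T := IsHomLift.domain_eq F.p t c
    have hγ' : (functor g).map ((functor f).map γ) = (functor g).map ((functor f).map c ≫ β) :=
      hγ.trans ((functor g).map_comp _ _).symm
    refine ((hg.inj _ _ ((BasedFunctor.w_obj _ x').trans hx') hγ').comap f).mono ?_
    intro x'' d hd
    refine ⟨d ≫ γ, ?_⟩
    rw [Functor.map_comp, hd, Functor.map_comp, Category.assoc]
  · intro S y hy
    refine ((hfg.essSurj ((functor g).obj y) ((BasedFunctor.w_obj _ y).trans hy)).comap g).bind
      hy ?_
    rintro T t y' c hc ⟨x, ⟨e⟩⟩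
    -- A cartesian arrow from `y''` to `f x` identifies `y''` with the image of an inverse image of
    -- `x`.
    refine (hg.locally_exists_isCartesian (a := (functor f).obj x) e
      (IsHomLift.domain_eq G.p t c)).mono ?_
    rintro y'' d ⟨γ, T', S', t', hγ⟩
    have hx : F.p.obj x = S' :=
      (BasedFunctor.w_obj _ x).symm.trans (IsHomLift.codomain_eq G.p t' γ)
    have := Hom.map_isCartesian f t' (Functor.IsPreFibered.pullbackMap hx t') inferInstance
    exact ⟨_, ⟨Functor.IsCartesian.domainUniqueUpToIso G.p t' γ
      ((functor f).map (Functor.IsPreFibered.pullbackMap hx t'))⟩⟩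

/-- Objects of `G` come locally from `F`, so questions about arrows of `G` reduce to arrows between
objects `f x₀` and `f y₀`, where `f` and `f ≫ g` are both controlled. -/
lemma bicoverings.of_comp_left {f : F ⟶ G} {g : G ⟶ H} (hf : bicoverings J f)
    (hfg : bicoverings J (f ≫ g)) : bicoverings J g := by
  refine bicoverings_mk ?_ ?_ ?_
  · intro S x y a b hx hab
    -- The target is restricted along the base arrow of `a`, so that source and target are in the
    -- image of `f` over the same object of `E`.
    refine ((hf.essSurj x hx).and
      ((hf.essSurj y rfl).pull (𝟙 G) (𝟙 G) a hx rfl)).bind hx ?_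
    rintro T t x' c hc ⟨⟨x₀, ⟨i⟩⟩, y', d, ⟨y₀, ⟨j⟩⟩, hd⟩
    change G.p.IsCartesian (G.p.map (c ≫ a)) d at hd
    have hb : G.p.IsHomLift (G.p.map (c ≫ a)) (c ≫ b) := by
      have hcab : (functor g).map (c ≫ b) = (functor g).map (c ≫ a) := by
        rw [Functor.map_comp, Functor.map_comp, hab]
      rw [← isHomLift_functor_map_iff g, hcab, isHomLift_functor_map_iff g]
      infer_instance
    let a' := Functor.IsCartesian.map G.p (G.p.map (c ≫ a)) d (c ≫ a)
    let b' := Functor.IsCartesian.map G.p (G.p.map (c ≫ a)) d (c ≫ b)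
    have ha' : a' ≫ d = c ≫ a := Functor.IsCartesian.fac _ _ _ _
    have hb' : b' ≫ d = c ≫ b := Functor.IsCartesian.fac _ _ _ _
    have hla : G.p.IsHomLift (𝟙 (G.p.obj x')) a' := inferInstance
    have hlb : G.p.IsHomLift (𝟙 (G.p.obj x')) b' := inferInstance
    have h₁ := (isHomLift_functor_map_iff g _ _).2 hla
    have h₂ := (isHomLift_functor_map_iff g _ _).2 hlb
    have h₃ := Hom.map_isCartesian g _ d hd
    have hgab : (functor g).map a' = (functor g).map b' := by
      refine Functor.IsCartesian.ext H.p (G.p.map (c ≫ a)) ((functor g).map d) _ _ ?_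
      rw [← Functor.map_comp, ← Functor.map_comp, ha', hb', Functor.map_comp, hab,
        Functor.map_comp]
    have key : Locally J (F.p.obj x₀) x₀ (fun _ k =>
        (functor f).map k ≫ i.hom ≫ a' = (functor f).map k ≫ i.hom ≫ b') := by
      refine ((hf.surj (i.hom ≫ a' ≫ j.inv) rfl).and
        (hf.surj (i.hom ≫ b' ≫ j.inv) rfl)).bind rfl ?_
      rintro T' t' x₁ k hk ⟨⟨α, hα⟩, β, hβ⟩
      have hαβ : (functor (f ≫ g)).map α = (functor (f ≫ g)).map β := by
        change (functor g).map ((functor f).map α) = (functor g).map ((functor f).map β)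
        rw [hα, hβ]
        simp only [Functor.map_comp, hgab]
      refine (hfg.inj α β (IsHomLift.domain_eq F.p t' k) hαβ).mono ?_
      intro x₂ l hl
      have := congrArg (fun m => (functor f).map m ≫ j.hom) hl
      simpa [hα, hβ] using this
    refine (key.transport f i rfl (IsHomLift.domain_eq G.p t c)).mono ?_
    rintro x'' k ⟨x₁, l, e, hl, hkl⟩
    rw [← reassoc_of% hkl, ← reassoc_of% hkl, cancel_epi] at hl
    rw [Category.assoc, Category.assoc, ← ha', ← hb', reassoc_of% hl]
  · intro S x y β hx
    refine ((hf.essSurj x hx).and ((hf.essSurj y rfl).pull g g β hx rfl)).bind hx ?_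
    rintro T t x' c hc ⟨⟨x₀, ⟨i⟩⟩, y', d, ⟨y₀, ⟨j⟩⟩, hd⟩
    let ε := Functor.IsCartesian.map H.p (H.p.map ((functor g).map c ≫ β)) ((functor g).map d)
      ((functor g).map c ≫ β)
    have hε : ε ≫ (functor g).map d = (functor g).map c ≫ β := Functor.IsCartesian.fac _ _ _ _
    refine ((hfg.surj (x := x₀) (y := y₀) ((functor g).map i.hom ≫ ε ≫ (functor g).map j.inv)
      rfl).transport f i rfl (IsHomLift.domain_eq G.p t c)).mono ?_
    rintro x'' k ⟨x₁, l, e, ⟨γ, hγ⟩, hkl⟩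
    replace hγ : (functor g).map ((functor f).map γ) = (functor g).map ((functor f).map l) ≫
        (functor g).map i.hom ≫ ε ≫ (functor g).map j.inv := hγ
    refine ⟨e.inv ≫ (functor f).map γ ≫ j.hom ≫ d, ?_⟩
    have hkl' : k = e.inv ≫ (functor f).map l ≫ i.hom := by rw [← hkl, Iso.inv_hom_id_assoc]
    rw [hkl']
    simp only [Functor.map_comp, hγ, Category.assoc, Iso.map_inv_hom_id_assoc, ← hε]
  · intro S z hz
    refine (hfg.essSurj z hz).mono ?_
    rintro z' d ⟨x, ⟨e⟩⟩
    exact ⟨(functor f).obj x, ⟨e⟩⟩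

lemma bicoverings_hasTwoOutOfThreeProperty :
    (bicoverings.{w} J).HasTwoOutOfThreeProperty where
  comp_mem _ _ := bicoverings.comp
  of_postcomp _ _ := bicoverings.of_comp_right
  of_precomp _ _ := bicoverings.of_comp_left

end FibredCat

/-! ### Isofibrations -/

section

variable {A B C : Type*} [Category A] [Category B] [Category C]

lemma isIsofibration_iff (P : A ⥤ B) :
    IsIsofibration P ↔ ∀ (a : A) (b : B) (i : P.obj a ≅ b), ∃ (a' : A) (h : P.obj a' = b)
      (e : a ≅ a'), P.map e.hom = i.hom ≫ eqToHom h.symm := by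
  refine forall₃_congr fun a b i => ⟨?_, ?_⟩
  · rintro ⟨a', e, he⟩
    refine ⟨a', IsHomLift.codomain_eq P i.hom e.hom, e, ?_⟩
    simpa using IsHomLift.fac' P i.hom e.hom
  · rintro ⟨a', h, e, he⟩
    exact ⟨a', e, IsHomLift.of_fac' P _ _ rfl h (by simpa using he)⟩

lemma IsIsofibration.comp {P : A ⥤ B} {Q : B ⥤ C} (hP : IsIsofibration P)
    (hQ : IsIsofibration Q) : IsIsofibration (P ⋙ Q) := by
  rw [isIsofibration_iff] at *
  intro a c i
  obtain ⟨b, h, e, he⟩ := hQ (P.obj a) c i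
  obtain ⟨a', h', e', he'⟩ := hP a b e
  refine ⟨a', by rw [Functor.comp_obj, h', h], e', ?_⟩
  rw [Functor.comp_map, he', Functor.map_comp, he, eqToHom_map, Category.assoc, eqToHom_trans]

end

namespace FibredCat

variable {E : Type u} [Category.{v} E]

lemma hom_ext {F G : FibredCat.{w} E} {u v : F ⟶ G} (h : functor u = functor v) : u = v := by
  obtain ⟨⟨u, _⟩, _⟩ := u
  obtain ⟨⟨v, _⟩, _⟩ := v
  obtain rfl : u = v := h
  rfl

section Iso

variable {F G : FibredCat.{w} E} (u : F ⟶ G) [IsIso u]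

lemma functor_comp_inv : functor u ⋙ functor (inv u) = 𝟭 _ :=
  congrArg functor (IsIso.hom_inv_id u)

lemma functor_inv_comp : functor (inv u) ⋙ functor u = 𝟭 _ :=
  congrArg functor (IsIso.inv_hom_id u)

lemma isEquivalence_of_isIso : (functor u).IsEquivalence :=
  (CategoryTheory.Equivalence.mk (functor u) (functor (inv u)) (eqToIso (functor_comp_inv u).symm)
    (eqToIso (functor_inv_comp u))).isEquivalence_functor

lemma isofibrations_of_isIso : isofibrations E u := by
  refine (isIsofibration_iff _).2 fun a b i => ?_
  have h := functor_inv_comp u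
  refine ⟨(functor (inv u)).obj b, Functor.congr_obj h b,
    eqToIso (Functor.congr_obj (functor_comp_inv u) a).symm ≪≫ (functor (inv u)).mapIso i, ?_⟩
  have := Functor.congr_hom h i.hom
  simp only [Functor.comp_map, Functor.id_map, Functor.comp_obj] at this
  simp [this, eqToHom_map]

end Iso

lemma isofibrations_comp {F G H : FibredCat.{w} E} {u : F ⟶ G} {v : G ⟶ H}
    (hu : isofibrations E u) (hv : isofibrations E v) : isofibrations E (u ≫ v) :=
  IsIsofibration.comp hu hv

/-! ### The terminal fibred category -/

section Terminal

attribute [local instance] uliftCategory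

lemma isStronglyCartesian_downFunctor {R S : E} (f : R ⟶ S) {a b : ULift.{max v w} E} (φ : a ⟶ b)
    (h : (ULift.downFunctor.{v, u, max v w} (C := E)).IsHomLift f φ) :
    (ULift.downFunctor.{v, u, max v w} (C := E)).IsStronglyCartesian f φ := by
  cases h
  refine { universal_property' := ?_ }
  intro a' g φ' hφ'
  have h := IsHomLift.eq_of_isHomLift ULift.downFunctor (g ≫ ULift.downFunctor.map φ) φ'
  refine ⟨g, ⟨IsHomLift.map ULift.downFunctor (a := a') (b := a) g, h⟩, ?_⟩
  rintro χ ⟨hχ, -⟩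
  exact (IsHomLift.eq_of_isHomLift ULift.downFunctor g χ).symm

/-- The category `E`, as a fibred category over itself. -/
def base (E : Type u) [Category.{v} E] : FibredCat.{w} E where
  toBased := BasedCategory.ofFunctor (ULift.downFunctor.{v, u, max v w} (C := E))
  isFibered := Functor.IsFibered.of_exists_isStronglyCartesian fun a R f =>
    ⟨ULift.up R, f, isStronglyCartesian_downFunctor f _
      (IsHomLift.map ULift.downFunctor (a := ULift.up R) (b := a) f)⟩

/-- The structure functor, as a map of fibred categories. -/
def toBase (F : FibredCat.{w} E) : F ⟶ base.{w} E where
  toBased := { toFunctor := F.p ⋙ ULift.upFunctor.{v, u, max v w}, w := rfl }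
  map_isCartesian f _ _ φ h := by
    have : (ULift.downFunctor.{v, u, max v w} (C := E)).IsHomLift f
        ((F.p ⋙ ULift.upFunctor.{v, u, max v w}).map φ) := by
      have := h.toIsHomLift
      cases this
      exact IsHomLift.map ULift.downFunctor _
    have := isStronglyCartesian_downFunctor.{w} f _ this
    exact inferInstanceAs ((ULift.downFunctor.{v, u, max v w} (C := E)).IsCartesian f
        ((F.p ⋙ ULift.upFunctor.{v, u, max v w}).map φ))

lemma eq_toBase {F : FibredCat.{w} E} (u : F ⟶ base.{w} E) : u = toBase F := by
  refine hom_ext ?_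
  have h : functor u ⋙ (base.{w} E).p = F.p := (Hom.toBased u).w
  have : functor u = (functor u ⋙ (base.{w} E).p) ⋙ ULift.upFunctor.{v, u, max v w} := rfl
  rw [this, h]
  rfl

/-- The category `E` is a terminal object of `Fib(E)`. -/
def isTerminalBase : IsTerminal (base.{w} E) :=
  IsTerminal.ofUniqueHom toBase fun _ => eq_toBase

/-- Cartesian lifts have a prescribed target, while here the source is prescribed: the inverse
isomorphism is lifted, and the lift is inverted. -/
lemma isofibrations_toBase (F : FibredCat.{w} E) : isofibrations E (toBase F) := by
  refine (isIsofibration_iff _).2 fun a b i => ?_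
  let j : F.p.obj a ≅ (base.{w} E).p.obj b := (base.{w} E).p.mapIso i
  let c := Functor.IsPreFibered.pullbackMap (p := F.p) (a := a) rfl j.inv
  have : IsIso c := Functor.IsStronglyCartesian.isIso_of_base_isIso F.p j.inv c
  have hc : F.p.IsHomLift j.hom (inv c) := by
    have := IsHomLift.inv F.p j.inv c
    simpa using this
  have hobj := IsHomLift.codomain_eq F.p j.hom (inv c)
  refine ⟨_, congrArg ULift.up hobj, (asIso c).symm, ?_⟩
  have := congrArg (ULift.upFunctor.{v, u, max v w} (C := E)).map
    (IsHomLift.fac' F.p j.hom (inv c))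
  simp only [Functor.map_comp, eqToHom_map, eqToHom_refl, Category.id_comp] at this
  exact this

end Terminal

lemma isofibrations_of_isTerminal {F T : FibredCat.{w} E} (hT : IsTerminal T) (u : F ⟶ T) :
    isofibrations E u := by
  rw [hT.hom_ext u (toBase F ≫ hT.from _)]
  have : IsIso (hT.from (base.{w} E)) :=
    ⟨toBase T, isTerminalBase.hom_ext _ _, hT.hom_ext _ _⟩
  exact isofibrations_comp (isofibrations_toBase F) (isofibrations_of_isIso _)

end FibredCat

namespace FibredCat

variable {E : Type u} [Category.{v} E]

lemma isHomLift_comp_iff {A B : Type*} [Category A] [Category B] (P : A ⥤ B) (p : B ⥤ E)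
    {R S : E} (f : R ⟶ S) {a b : A} (φ : a ⟶ b) :
    (P ⋙ p).IsHomLift f φ ↔ p.IsHomLift f (P.map φ) := by
  constructor <;> rintro ⟨⟩
  · exact IsHomLift.map p (P.map φ)
  · exact IsHomLift.map (P ⋙ p) φ

/-! ### Strict pullbacks -/

/-- The objects of the strict fibre product of two maps of `Fib(E)`. -/
@[ext]
structure StrictPullback {A B D : FibredCat.{w} E} (f : A ⟶ D) (g : B ⟶ D) where
  /-- the first component -/
  fst : A.Obj
  /-- the second component -/
  snd : B.Obj
  /-- the components have the same image -/
  w : (functor f).obj fst = (functor g).obj snd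

namespace StrictPullback

variable {A B D : FibredCat.{w} E} {f : A ⟶ D} {g : B ⟶ D}

/-- The arrows of the strict fibre product. -/
@[ext]
structure Hom (X Y : StrictPullback f g) where
  /-- the first component -/
  fst : X.fst ⟶ Y.fst
  /-- the second component -/
  snd : X.snd ⟶ Y.snd
  /-- the components have the same image -/
  w : (functor f).map fst ≫ eqToHom Y.w = eqToHom X.w ≫ (functor g).map snd

instance : Category (StrictPullback f g) where
  Hom := Hom
  id X := ⟨𝟙 _, 𝟙 _, by simp⟩
  comp m n := ⟨m.fst ≫ n.fst, m.snd ≫ n.snd, by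
    rw [Functor.map_comp, Functor.map_comp, Category.assoc, n.w, reassoc_of% m.w]⟩

@[ext]
lemma hom_ext {X Y : StrictPullback f g} {m n : X ⟶ Y} (h₁ : Hom.fst m = Hom.fst n)
    (h₂ : Hom.snd m = Hom.snd n) : m = n :=
  Hom.ext h₁ h₂

variable (f g) in
/-- The first projection. -/
@[simps]
def fstFunctor : StrictPullback f g ⥤ A.Obj where
  obj := fst
  map := Hom.fst

variable (f g) in
/-- The second projection. -/
@[simps]
def sndFunctor : StrictPullback f g ⥤ B.Obj where
  obj := snd
  map := Hom.snd

variable (f g) in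
/-- The structure functor. -/
abbrev proj : StrictPullback f g ⥤ E := fstFunctor f g ⋙ A.p

lemma isHomLift_fst_iff {X Y : StrictPullback f g} {R S : E} (h : R ⟶ S) (m : X ⟶ Y) :
    A.p.IsHomLift h (Hom.fst m) ↔ (proj f g).IsHomLift h m :=
  (isHomLift_comp_iff (fstFunctor f g) A.p h m).symm

lemma isHomLift_snd_iff {X Y : StrictPullback f g} {R S : E} (h : R ⟶ S) (m : X ⟶ Y) :
    B.p.IsHomLift h (Hom.snd m) ↔ (proj f g).IsHomLift h m := by
  rw [← isHomLift_fst_iff, ← isHomLift_functor_map_iff f, ← isHomLift_functor_map_iff g,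
    ← IsHomLift.eqToHom_comp_lift_iff _ _ _ Y.w, Hom.w m, IsHomLift.comp_eqToHom_lift_iff]

variable (f g) in
lemma sndFunctor_comp_p : sndFunctor f g ⋙ B.p = proj f g := by
  refine CategoryTheory.Functor.ext (fun X => ?_) fun X Y m => ?_
  · exact (BasedFunctor.w_obj (FibredCat.Hom.toBased g) X.snd).symm.trans
      ((congrArg D.p.obj X.w.symm).trans (BasedFunctor.w_obj (FibredCat.Hom.toBased f) X.fst))
  · have := (isHomLift_snd_iff ((proj f g).map m) m).2 inferInstance
    exact IsHomLift.fac' B.p ((proj f g).map m) (Hom.snd m)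

lemma isStronglyCartesian {X Y : StrictPullback f g} {R S : E} {h : R ⟶ S} (m : X ⟶ Y)
    (h₁ : A.p.IsCartesian h (Hom.fst m)) (h₂ : B.p.IsCartesian h (Hom.snd m)) :
    (proj f g).IsStronglyCartesian h m := by
  have : (proj f g).IsHomLift h m := (isHomLift_fst_iff h m).1 inferInstance
  refine { universal_property' := ?_ }
  intro Z k n hn
  have hn₁ := (isHomLift_fst_iff _ n).2 hn
  have hn₂ := (isHomLift_snd_iff _ n).2 hn
  let a := Functor.IsStronglyCartesian.map A.p h (Hom.fst m) (f' := k ≫ h) (g := k) rfl (Hom.fst n)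
  let b := Functor.IsStronglyCartesian.map B.p h (Hom.snd m) (f' := k ≫ h) (g := k) rfl (Hom.snd n)
  have ha : a ≫ Hom.fst m = Hom.fst n := Functor.IsStronglyCartesian.fac _ _ _ _ _
  have hb : b ≫ Hom.snd m = Hom.snd n := Functor.IsStronglyCartesian.fac _ _ _ _ _
  have hla := (isHomLift_functor_map_iff f k a).2 inferInstance
  have hlb := (isHomLift_functor_map_iff g k b).2 inferInstance
  have hm := FibredCat.Hom.map_isCartesian g h _ h₂
  refine ⟨⟨a, b, ?_⟩, ⟨(isHomLift_fst_iff _ _).1 ?_, hom_ext ha hb⟩, ?_⟩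
  -- The componentwise factorizations have compatible images because these agree after composition
  -- with a cartesian arrow of `D`.
  · refine Functor.IsStronglyCartesian.ext D.p h ((functor g).map (Hom.snd m)) k ?_
    rw [Category.assoc, Category.assoc, ← Hom.w m, ← Functor.map_comp, ← Functor.map_comp_assoc,
      ha, hb, Hom.w n]
  · exact inferInstanceAs (A.p.IsHomLift k a)
  · rintro n' ⟨hn', rfl⟩
    have h₁' := (isHomLift_fst_iff _ n').2 hn'
    have h₂' := (isHomLift_snd_iff _ n').2 hn'
    exact hom_ext (Functor.IsStronglyCartesian.map_uniq A.p h _ rfl _ _ rfl)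
      (Functor.IsStronglyCartesian.map_uniq B.p h _ rfl _ _ rfl)

/-- The lifts `α` and `β` of the components have cartesian images in `D`, with isomorphic but
perhaps different sources. Lifting this isomorphism along `g` to `e` and replacing `β` by `e.inv ≫
β` makes the sources match. -/
lemma exists_isCartesian (hg : isofibrations E g) (Y : StrictPullback f g) {R S : E}
    (hY : A.p.obj Y.fst = S) (h : R ⟶ S) :
    ∃ (X : StrictPullback f g) (m : X ⟶ Y),
      A.p.IsCartesian h (Hom.fst m) ∧ B.p.IsCartesian h (Hom.snd m) := by
  have hY' : B.p.obj Y.snd = S := (Functor.congr_obj (sndFunctor_comp_p f g) Y).trans hY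
  let α := Functor.IsPreFibered.pullbackMap hY h
  let β := Functor.IsPreFibered.pullbackMap hY' h
  have hα := FibredCat.Hom.map_isCartesian f h α inferInstance
  have hβ := FibredCat.Hom.map_isCartesian g h β inferInstance
  have hα' : D.p.IsCartesian h ((functor f).map α ≫ eqToHom Y.w) := by
    have hid : D.p.IsHomLift (𝟙 S) (eqToHom Y.w) :=
      IsHomLift.eqToHom_domain_lift_id _ ((BasedFunctor.w_obj _ _).trans hY)
    have : D.p.IsStronglyCartesian (h ≫ 𝟙 S) ((functor f).map α ≫ eqToHom Y.w) := inferInstance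
    rw [Category.comp_id] at this
    infer_instance
  let i := Functor.IsCartesian.domainUniqueUpToIso D.p h ((functor f).map α ≫ eqToHom Y.w)
    ((functor g).map β)
  have hi : i.hom ≫ (functor f).map α ≫ eqToHom Y.w = (functor g).map β :=
    Functor.IsCartesian.fac D.p h _ _
  have hil : D.p.IsHomLift (𝟙 R) i.hom := inferInstanceAs
    (D.p.IsHomLift (𝟙 R) (Functor.IsCartesian.map D.p h ((functor f).map α ≫ eqToHom Y.w)
      ((functor g).map β)))
  obtain ⟨b, hb, e, he⟩ := (isIsofibration_iff _).1 hg _ _ i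
  have hel : B.p.IsHomLift (𝟙 R) e.hom := by
    rw [← isHomLift_functor_map_iff g, he]
    infer_instance
  have hcart : B.p.IsStronglyCartesian (𝟙 R ≫ h) (e.inv ≫ β) := inferInstance
  rw [Category.id_comp] at hcart
  have h₁ : A.p.IsCartesian h α := inferInstance
  have h₂ : B.p.IsCartesian h (e.inv ≫ β) := inferInstance
  refine ⟨⟨_, b, hb.symm⟩, ⟨α, e.inv ≫ β, ?_⟩, h₁, h₂⟩
  have he' : i.hom = (functor g).map e.hom ≫ eqToHom hb := by rw [he]; simp
  rw [Functor.map_comp, ← hi, he']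
  simp

/-- By uniqueness of cartesian lifts, `m` differs by a vertical isomorphism from one with cartesian
components. This makes the projections cartesian functors. -/
lemma isCartesian_components (hg : isofibrations E g) {X Y : StrictPullback f g} {R S : E}
    {h : R ⟶ S} (m : X ⟶ Y) (hm : (proj f g).IsCartesian h m) :
    A.p.IsCartesian h (Hom.fst m) ∧ B.p.IsCartesian h (Hom.snd m) := by
  obtain ⟨X', m', h₁, h₂⟩ := exists_isCartesian hg Y (IsHomLift.codomain_eq (proj f g) h m) h
  have := isStronglyCartesian m' h₁ h₂
  let i := Functor.IsCartesian.domainUniqueUpToIso (proj f g) h m' m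
  have hi : i.hom ≫ m' = m := Functor.IsCartesian.fac (proj f g) h _ _
  have hil : (proj f g).IsHomLift (𝟙 R) i.hom := inferInstanceAs
    ((proj f g).IsHomLift (𝟙 R) (Functor.IsCartesian.map (proj f g) h m' m))
  have hi₁ : IsIso (Hom.fst i.hom) := inferInstanceAs (IsIso ((fstFunctor f g).map i.hom))
  have hi₂ : IsIso (Hom.snd i.hom) := inferInstanceAs (IsIso ((sndFunctor f g).map i.hom))
  have hl₁ := (isHomLift_fst_iff _ i.hom).2 hil
  have hl₂ := (isHomLift_snd_iff _ i.hom).2 hil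
  have c₁ : A.p.IsStronglyCartesian (𝟙 R ≫ h) (Hom.fst i.hom ≫ Hom.fst m') := inferInstance
  have c₂ : B.p.IsStronglyCartesian (𝟙 R ≫ h) (Hom.snd i.hom ≫ Hom.snd m') := inferInstance
  rw [Category.id_comp] at c₁ c₂
  rw [← hi]
  exact ⟨inferInstanceAs (A.p.IsCartesian h (Hom.fst i.hom ≫ Hom.fst m')),
    inferInstanceAs (B.p.IsCartesian h (Hom.snd i.hom ≫ Hom.snd m'))⟩

lemma map_fst_eq {X Y : StrictPullback f g} (m : X ⟶ Y) :
    (functor f).map (Hom.fst m) =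
      eqToHom X.w ≫ (functor g).map (Hom.snd m) ≫ eqToHom Y.w.symm := by
  rw [← reassoc_of% (Hom.w m)]
  simp

lemma eqToHom_comp_fst {X X' Y Y' : StrictPullback f g} (h : X = X') (h' : Y' = Y) (m : X' ⟶ Y') :
    Hom.fst (eqToHom h ≫ m ≫ eqToHom h') =
      eqToHom (congrArg fst h) ≫ Hom.fst m ≫ eqToHom (congrArg fst h') := by
  subst h h'
  simp

lemma eqToHom_comp_snd {X X' Y Y' : StrictPullback f g} (h : X = X') (h' : Y' = Y) (m : X' ⟶ Y') :
    Hom.snd (eqToHom h ≫ m ≫ eqToHom h') =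
      eqToHom (congrArg snd h) ≫ Hom.snd m ≫ eqToHom (congrArg snd h') := by
  subst h h'
  simp

lemma w_of_fst {X' X Y : StrictPullback f g} (c : X' ⟶ X) (α : X.fst ⟶ Y.fst)
    (γ : X'.snd ⟶ Y.snd) (hγ : (functor g).map γ = (functor g).map (Hom.snd c) ≫
      eqToHom X.w.symm ≫ (functor f).map α ≫ eqToHom Y.w) :
    (functor f).map (Hom.fst c ≫ α) ≫ eqToHom Y.w = eqToHom X'.w ≫ (functor g).map γ := by
  rw [hγ, ← reassoc_of% (Hom.w c)]
  simp

lemma w_of_snd {X' X Y : StrictPullback f g} (c : X' ⟶ X) (β : X.snd ⟶ Y.snd)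
    (γ : X'.fst ⟶ Y.fst) (hγ : (functor f).map γ = (functor f).map (Hom.fst c) ≫
      eqToHom X.w ≫ (functor g).map β ≫ eqToHom Y.w.symm) :
    (functor f).map γ ≫ eqToHom Y.w = eqToHom X'.w ≫ (functor g).map (Hom.snd c ≫ β) := by
  rw [hγ, Functor.map_comp, ← reassoc_of% (Hom.w c)]
  simp

end StrictPullback

open StrictPullback

variable {A B D : FibredCat.{w} E} (f : A ⟶ D) (g : B ⟶ D) (hg : isofibrations E g)

/-- The strict fibre product of a map of `Fib(E)` and an isofibration. -/
def strictPullback : FibredCat.{w} E where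
  toBased := BasedCategory.ofFunctor (proj f g)
  isFibered := Functor.IsFibered.of_exists_isStronglyCartesian fun Y R h => by
    obtain ⟨X, m, h₁, h₂⟩ := exists_isCartesian hg Y rfl h
    exact ⟨X, m, isStronglyCartesian m h₁ h₂⟩

namespace strictPullback

/-- The first projection. -/
def fst : strictPullback f g hg ⟶ A where
  toBased := { toFunctor := fstFunctor f g, w := rfl }
  map_isCartesian _ _ _ m hm := (isCartesian_components hg m hm).1

/-- The second projection. -/
def snd : strictPullback f g hg ⟶ B where
  toBased := { toFunctor := sndFunctor f g, w := sndFunctor_comp_p f g }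
  map_isCartesian _ _ _ m hm := (isCartesian_components hg m hm).2

lemma condition : fst f g hg ≫ f = snd f g hg ≫ g := by
  exact hom_ext (CategoryTheory.Functor.ext (fun X => X.w) fun X Y m => map_fst_eq m)

variable {f g} {W : FibredCat.{w} E}

/-- The map to the strict fibre product given by its components. -/
def lift (s : W ⟶ A) (t : W ⟶ B) (hst : s ≫ f = t ≫ g) : W ⟶ strictPullback f g hg where
  toBased :=
    { toFunctor :=
        { obj x := ⟨(functor s).obj x, (functor t).obj x,
            Functor.congr_obj (congrArg functor hst) x⟩
          map m := ⟨(functor s).map m, (functor t).map m, by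
            have h : ∀ x, (functor f).obj ((functor s).obj x) = (functor g).obj ((functor t).obj x) :=
              Functor.congr_obj (congrArg functor hst)
            have : (functor f).map ((functor s).map m) = eqToHom (h _) ≫
                (functor g).map ((functor t).map m) ≫ eqToHom (h _).symm :=
              Functor.congr_hom (congrArg functor hst) m
            rw [this]
            simp⟩
          map_id x := StrictPullback.hom_ext ((functor s).map_id x) ((functor t).map_id x)
          map_comp m n := StrictPullback.hom_ext ((functor s).map_comp m n)
            ((functor t).map_comp m n) }
      w := (Hom.toBased s).w }
  map_isCartesian h _ _ m hm :=
    @Functor.IsStronglyCartesian.isCartesian_of_isStronglyCartesian _ _ _ _ _ _ _ _ _ _ _ <|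
      isStronglyCartesian _ (Hom.map_isCartesian s h m hm) (Hom.map_isCartesian t h m hm)

lemma hom_ext_of_projections {m n : W ⟶ strictPullback f g hg} (h₁ : m ≫ fst f g hg = n ≫ fst f g hg)
    (h₂ : m ≫ snd f g hg = n ≫ snd f g hg) : m = n := by
  replace h₁ := congrArg functor h₁
  replace h₂ := congrArg functor h₂
  refine hom_ext (CategoryTheory.Functor.ext (fun x => ?_) fun x y k => ?_)
  · exact StrictPullback.ext (Functor.congr_obj h₁ x) (Functor.congr_obj h₂ x)
  · exact StrictPullback.hom_ext
      ((Functor.congr_hom h₁ k).trans (eqToHom_comp_fst _ _ ((functor n).map k)).symm)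
      ((Functor.congr_hom h₂ k).trans (eqToHom_comp_snd _ _ ((functor n).map k)).symm)

lemma isPullback : IsPullback (fst f g hg) (snd f g hg) f g where
  w := condition f g hg
  isLimit' := ⟨PullbackCone.IsLimit.mk _ (fun s => lift hg s.fst s.snd s.condition)
    (fun _ => rfl) (fun _ => rfl) fun _ _ h₁ h₂ => hom_ext_of_projections hg h₁ h₂⟩

lemma isofibrations_fst : isofibrations E (fst f g hg) := by
  refine (isIsofibration_iff _).2 fun X a i => ?_
  change X.fst ≅ a at i
  obtain ⟨b, hb, e, he⟩ := (isIsofibration_iff _).1 hg X.snd ((functor f).obj a)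
    (eqToIso X.w.symm ≪≫ (functor f).mapIso i)
  have he₁ : (functor f).map i.hom ≫ eqToHom hb.symm = eqToHom X.w ≫ (functor g).map e.hom := by
    rw [he]
    simp
  have he₂ : (functor f).map i.inv ≫ eqToHom X.w = eqToHom hb.symm ≫ (functor g).map e.inv := by
    rw [← cancel_epi ((functor f).map i.hom), ← Functor.map_comp_assoc, i.hom_inv_id,
      reassoc_of% he₁, ← Functor.map_comp, e.hom_inv_id]
    simp
  let X' : StrictPullback f g := ⟨a, b, hb.symm⟩
  let j : X ≅ X' :=
    { hom := ⟨i.hom, e.hom, he₁⟩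
      inv := ⟨i.inv, e.inv, he₂⟩
      hom_inv_id := StrictPullback.hom_ext i.hom_inv_id e.hom_inv_id
      inv_hom_id := StrictPullback.hom_ext i.inv_hom_id e.inv_hom_id }
  exact ⟨X', rfl, j, (Category.comp_id _).symm⟩

variable {J : GrothendieckTopology E}

/-- Once the first component of an arrow is fixed, the second is an arrow of `B` with prescribed
image in `D`, which is what `g` controls. For objects, the isofibration turns `g b ≅ f a'` into an
equality. -/
lemma bicoverings_fst (h : bicoverings J g) : bicoverings J (fst f g hg) := by
  refine bicoverings_mk ?_ ?_ ?_
  · intro S X Y m n hX hmn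
    replace hmn : Hom.fst m = Hom.fst n := hmn
    have hw : (functor g).map (Hom.snd m) = (functor g).map (Hom.snd n) := by
      rw [← cancel_epi (eqToHom X.w), ← Hom.w m, ← Hom.w n, hmn]
    have hX' : B.p.obj X.snd = S := (Functor.congr_obj (sndFunctor_comp_p f g) X).trans hX
    refine ((h.inj _ _ hX' hw).comap (snd f g hg) (x := X)).mono fun X' c hc => ?_
    refine StrictPullback.hom_ext ?_ hc
    exact congrArg (Hom.fst c ≫ ·) hmn
  · intro S X Y α hX
    change X.fst ⟶ Y.fst at α
    have hX' : B.p.obj X.snd = S := (Functor.congr_obj (sndFunctor_comp_p f g) X).trans hX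
    refine ((h.surj (eqToHom X.w.symm ≫ (functor f).map α ≫ eqToHom Y.w) hX').comap
      (snd f g hg) (x := X)).mono ?_
    rintro X' c ⟨γ, hγ⟩
    exact ⟨⟨Hom.fst c ≫ α, γ, w_of_fst c α γ hγ⟩, rfl⟩
  · intro S a ha
    refine ((h.essSurj ((functor f).obj a) ((BasedFunctor.w_obj _ a).trans ha)).comap f).mono ?_
    rintro a' c ⟨b, ⟨e⟩⟩
    obtain ⟨b', hb', -, -⟩ := (isIsofibration_iff _).1 hg b _ e
    exact ⟨(⟨a', b', hb'.symm⟩ : StrictPullback f g), ⟨Iso.refl a'⟩⟩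

lemma bicoverings_snd (h : bicoverings J f) : bicoverings J (snd f g hg) := by
  refine bicoverings_mk ?_ ?_ ?_
  · intro S X Y m n hX hmn
    replace hmn : Hom.snd m = Hom.snd n := hmn
    have hw : (functor f).map (Hom.fst m) = (functor f).map (Hom.fst n) := by
      rw [← cancel_mono (eqToHom Y.w), Hom.w m, Hom.w n, hmn]
    refine ((h.inj _ _ hX hw).comap (fst f g hg) (x := X)).mono fun X' c hc => ?_
    refine StrictPullback.hom_ext hc ?_
    exact congrArg (Hom.snd c ≫ ·) hmn
  · intro S X Y β hX
    change X.snd ⟶ Y.snd at β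
    refine ((h.surj (eqToHom X.w ≫ (functor g).map β ≫ eqToHom Y.w.symm) hX).comap
      (fst f g hg) (x := X)).mono ?_
    rintro X' c ⟨γ, hγ⟩
    exact ⟨⟨γ, Hom.snd c ≫ β, w_of_snd c β γ hγ⟩, rfl⟩
  · intro S b hb
    refine ((h.essSurj ((functor g).obj b) ((BasedFunctor.w_obj _ b).trans hb)).comap g).mono ?_
    rintro b' c ⟨a, ⟨e⟩⟩
    -- The given object `b'` itself is moved, so the second projection only reaches it up to the
    -- isomorphism `i`.
    obtain ⟨b'', hb'', i, -⟩ := (isIsofibration_iff _).1 hg b' _ e.symm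
    exact ⟨(⟨a, b'', hb''.symm⟩ : StrictPullback f g), ⟨i.symm⟩⟩

end strictPullback

end FibredCat

namespace FibredCat

variable {E : Type u} [Category.{v} E]

/-! ### Path objects -/

/-- The objects of the path object of `B`: the vertical isomorphisms of `B`. -/
structure PathSpace (B : FibredCat.{w} E) where
  /-- the source -/
  left : B.Obj
  /-- the target -/
  right : B.Obj
  /-- the isomorphism -/
  iso : left ≅ right
  /-- the isomorphism is vertical -/
  vertical : B.p.IsHomLift (𝟙 (B.p.obj left)) iso.hom

namespace PathSpace

variable {B : FibredCat.{w} E}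

/-- The arrows of the path object: squares are determined by their source. -/
@[ext]
structure Hom (X Y : PathSpace B) where
  /-- the underlying arrow between the sources -/
  left : X.left ⟶ Y.left

instance : Category (PathSpace B) where
  Hom := Hom
  id X := ⟨𝟙 X.left⟩
  comp m n := ⟨m.left ≫ n.left⟩

/-- The arrow between the targets. -/
def Hom.right {X Y : PathSpace B} (m : X ⟶ Y) : X.right ⟶ Y.right :=
  X.iso.inv ≫ Hom.left m ≫ Y.iso.hom

variable (B) in
/-- The source functor. -/
def leftFunctor : PathSpace B ⥤ B.Obj where
  obj := left
  map := Hom.left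

variable (B) in
/-- The target functor. -/
def rightFunctor : PathSpace B ⥤ B.Obj where
  obj := right
  map := Hom.right
  map_id X := by
    change X.iso.inv ≫ 𝟙 X.left ≫ X.iso.hom = _
    simp
  map_comp {X Y Z} m n := by
    change X.iso.inv ≫ (Hom.left m ≫ Hom.left n) ≫ Z.iso.hom =
      (X.iso.inv ≫ Hom.left m ≫ Y.iso.hom) ≫ Y.iso.inv ≫ Hom.left n ≫ Z.iso.hom
    simp

/-- The identities, as objects of the path object. -/
def refl (x : B.Obj) : PathSpace B := ⟨x, x, Iso.refl x, IsHomLift.id rfl⟩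

lemma isHomLift_inv (X : PathSpace B) : B.p.IsHomLift (𝟙 (B.p.obj X.left)) X.iso.inv :=
  have := X.vertical
  IsHomLift.lift_id_inv B.p _ X.iso

lemma isHomLift_right {X Y : PathSpace B} (m : X ⟶ Y) :
    B.p.IsHomLift (B.p.map (Hom.left m)) (Hom.right m) := by
  have := X.isHomLift_inv
  have := Y.vertical
  have h := IsHomLift.comp B.p (𝟙 _) (B.p.map (Hom.left m) ≫ 𝟙 (B.p.obj Y.left))
    X.iso.inv (Hom.left m ≫ Y.iso.hom)
  rw [Category.id_comp, Category.comp_id] at h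
  exact h

lemma isCartesian_right {X Y : PathSpace B} {R S : E} (h : R ⟶ S) (m : X ⟶ Y)
    (hm : B.p.IsCartesian h (Hom.left m)) : B.p.IsCartesian h (Hom.right m) := by
  have hl := hm.toIsHomLift
  cases hl
  have := X.isHomLift_inv
  have := Y.vertical
  have h₁ : B.p.IsStronglyCartesian (𝟙 (B.p.obj X.left) ≫ B.p.map (Hom.left m) ≫
      𝟙 (B.p.obj Y.left)) (X.iso.inv ≫ Hom.left m ≫ Y.iso.hom) := inferInstance
  rw [Category.id_comp, Category.comp_id] at h₁
  exact inferInstanceAs (B.p.IsCartesian _ (X.iso.inv ≫ Hom.left m ≫ Y.iso.hom))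

lemma rightFunctor_comp_p : rightFunctor B ⋙ B.p = leftFunctor B ⋙ B.p := by
  refine CategoryTheory.Functor.ext (fun X => ?_) fun X Y m => ?_
  · have := X.vertical
    have h := IsHomLift.codomain_eq B.p (𝟙 (B.p.obj X.left)) X.iso.hom
    exact h
  · have := isHomLift_right m
    exact IsHomLift.fac' B.p (B.p.map (Hom.left m)) (Hom.right m)

lemma isHomLift_iff {X Y : PathSpace B} {R S : E} (h : R ⟶ S) (m : X ⟶ Y) :
    (leftFunctor B ⋙ B.p).IsHomLift h m ↔ B.p.IsHomLift h (Hom.left m) :=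
  isHomLift_comp_iff (leftFunctor B) B.p h m

lemma isStronglyCartesian {X Y : PathSpace B} {R S : E} (h : R ⟶ S) (m : X ⟶ Y)
    (hm : B.p.IsCartesian h (Hom.left m)) : (leftFunctor B ⋙ B.p).IsStronglyCartesian h m := by
  have := (isHomLift_iff h m).2 inferInstance
  refine { universal_property' := ?_ }
  intro Z g n hn
  have := (isHomLift_iff _ n).1 hn
  obtain ⟨χ, ⟨h₁, h₂⟩, h₃⟩ := Functor.IsStronglyCartesian.universal_property B.p h
    (Hom.left m) g _ rfl (Hom.left n)
  exact ⟨⟨χ⟩, ⟨(isHomLift_iff (Y := X) g ⟨χ⟩).2 h₁, Hom.ext h₂⟩,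
    fun ψ hψ => Hom.ext (h₃ (Hom.left ψ) ⟨(isHomLift_iff g ψ).1 hψ.1, congrArg Hom.left hψ.2⟩)⟩

/-- Arrows out of `refl z` are arrows out of `z`, so testing against constant paths gives the
universal property in `B`. -/
lemma isCartesian_left {X Y : PathSpace B} {R S : E} (h : R ⟶ S) (m : X ⟶ Y)
    (hm : (leftFunctor B ⋙ B.p).IsCartesian h m) : B.p.IsCartesian h (Hom.left m) := by
  have := (isHomLift_iff h m).1 inferInstance
  refine { universal_property := ?_ }
  intro z n hn
  have := (isHomLift_iff (X := refl z) (Y := Y) h ⟨n⟩).2 hn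
  obtain ⟨χ, ⟨h₁, h₂⟩, h₃⟩ := hm.universal_property (a' := refl z) ⟨n⟩
  exact ⟨Hom.left χ, ⟨(isHomLift_iff _ χ).1 h₁, congrArg Hom.left h₂⟩,
    fun ψ hψ => congrArg Hom.left
      (h₃ ⟨ψ⟩ ⟨(isHomLift_iff (X := refl z) (Y := X) _ ⟨ψ⟩).2 hψ.1, Hom.ext hψ.2⟩)⟩

end PathSpace

open PathSpace

/-- The path object of a fibred category. -/
def pathSpace (B : FibredCat.{w} E) : FibredCat.{w} E where
  toBased := BasedCategory.ofFunctor (leftFunctor B ⋙ B.p)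
  isFibered := Functor.IsFibered.of_exists_isStronglyCartesian fun Y _ h =>
    ⟨refl _, ⟨Functor.IsPreFibered.pullbackMap (p := B.p) (a := Y.left) rfl h⟩,
      PathSpace.isStronglyCartesian (X := refl _) h _
        (Functor.IsPreFibered.pullbackMap.IsCartesian (p := B.p) (a := Y.left) rfl h)⟩

namespace pathSpace

variable (B : FibredCat.{w} E)

/-- The source map. -/
def left : pathSpace B ⟶ B where
  toBased := { toFunctor := leftFunctor B, w := rfl }
  map_isCartesian h _ _ m hm := isCartesian_left h m hm

/-- The target map. -/
def right : pathSpace B ⟶ B where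
  toBased := { toFunctor := rightFunctor B, w := rightFunctor_comp_p }
  map_isCartesian h _ _ m hm := isCartesian_right h m (isCartesian_left h m hm)

/-- The map of constant paths. -/
def const : B ⟶ pathSpace B where
  toBased :=
    { toFunctor :=
        { obj := refl
          map m := ⟨m⟩ }
      w := rfl }
  map_isCartesian h a b m hm :=
    @Functor.IsStronglyCartesian.isCartesian_of_isStronglyCartesian _ _ _ _ _ _ _ _ _ _ _ <|
      PathSpace.isStronglyCartesian (X := refl a) (Y := refl b) h ⟨m⟩ hm

lemma const_left : const B ≫ left B = 𝟙 B := rfl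

lemma const_right : const B ≫ right B = 𝟙 B := by
  refine hom_ext (CategoryTheory.Functor.ext (fun _ => rfl) fun x y m => ?_)
  change 𝟙 x ≫ m ≫ 𝟙 y = 𝟙 x ≫ m ≫ 𝟙 y
  rfl

/-- Arrows of paths are arrows of sources, so each path is isomorphic to the constant path at its
source. -/
lemma isEquivalence_const : (functor (const B)).IsEquivalence where
  faithful := ⟨fun h => congrArg PathSpace.Hom.left h⟩
  full := ⟨fun m => ⟨PathSpace.Hom.left m, rfl⟩⟩
  essSurj := ⟨fun X => ⟨PathSpace.left X, ⟨
    { hom := ⟨𝟙 (PathSpace.left X)⟩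
      inv := ⟨𝟙 (PathSpace.left X)⟩
      hom_inv_id := PathSpace.Hom.ext (Category.comp_id (𝟙 (PathSpace.left X)))
      inv_hom_id := PathSpace.Hom.ext (Category.comp_id (𝟙 (PathSpace.left X))) }⟩⟩⟩

/-- The square of a fibred category, as a strict fibre product over the base. -/
abbrev square : FibredCat.{w} E :=
  strictPullback (toBase B) (toBase B) (isofibrations_toBase B)

/-- The endpoints of a path. -/
def endpoints : pathSpace B ⟶ square B :=
  strictPullback.lift _ (left B) (right B) (isTerminalBase.hom_ext _ _)

/-- The path is conjugated by the isomorphisms `j₁`, `j₂` of its endpoints; the result is vertical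
because both lie over the same arrow of `E`. -/
lemma isofibrations_endpoints : isofibrations E (endpoints B) := by
  refine (isIsofibration_iff _).2 fun X b j => ?_
  let P : PathSpace B := X
  let b' : StrictPullback (toBase B) (toBase B) := b
  let j₁ : P.left ≅ b'.fst := (functor (strictPullback.fst _ _ _)).mapIso j
  let j₂ : P.right ≅ b'.snd := (functor (strictPullback.snd _ _ _)).mapIso j
  have hv : B.p.IsHomLift (𝟙 (B.p.obj b'.fst)) (j₁.inv ≫ P.iso.hom ≫ j₂.hom) := by
    have h₁ : B.p.IsHomLift (B.p.map j₁.hom) j₂.hom :=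
      (StrictPullback.isHomLift_snd_iff (B.p.map j₁.hom) j.hom).2
        ((StrictPullback.isHomLift_fst_iff (B.p.map j₁.hom) j.hom).1 (IsHomLift.map B.p j₁.hom))
    have h₂ := P.vertical
    have h₃ := IsHomLift.comp B.p (B.p.map j₁.inv) (𝟙 (B.p.obj P.left) ≫ B.p.map j₁.hom) j₁.inv
      (P.iso.hom ≫ j₂.hom)
    rw [Category.id_comp, ← Functor.map_comp, j₁.inv_hom_id, CategoryTheory.Functor.map_id] at h₃
    exact h₃
  let X' : PathSpace B := ⟨b'.fst, b'.snd, j₁.symm ≪≫ P.iso ≪≫ j₂, hv⟩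
  let e : P ≅ X' :=
    { hom := ⟨j₁.hom⟩
      inv := ⟨j₁.inv⟩
      hom_inv_id := PathSpace.Hom.ext j₁.hom_inv_id
      inv_hom_id := PathSpace.Hom.ext j₁.inv_hom_id }
  refine ⟨X', rfl, e, ?_⟩
  refine Eq.trans ?_ (Category.comp_id _).symm
  refine StrictPullback.hom_ext rfl ?_
  change P.iso.inv ≫ j₁.hom ≫ j₁.inv ≫ P.iso.hom ≫ j₂.hom = j₂.hom
  simp

end pathSpace

/-! ### Finite products -/

/-- The strict fibre product over the base is a product. -/
noncomputable def isLimitStrictPullback (A B : FibredCat.{w} E) :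
    IsLimit (BinaryFan.mk
      (strictPullback.fst (toBase A) (toBase B) (isofibrations_toBase B))
      (strictPullback.snd (toBase A) (toBase B) (isofibrations_toBase B))) :=
  isProductOfIsTerminalIsPullback _ _ _ _ isTerminalBase
    (strictPullback.isPullback (isofibrations_toBase B)).isLimit

instance : HasFiniteProducts (FibredCat.{w} E) :=
  have : HasTerminal (FibredCat.{w} E) := isTerminalBase.hasTerminal
  have : ∀ {A B : FibredCat.{w} E}, HasLimit (pair A B) :=
    fun {A B} => ⟨⟨⟨_, isLimitStrictPullback A B⟩⟩⟩
  have : HasBinaryProducts (FibredCat.{w} E) := hasBinaryProducts_of_hasLimit_pair _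
  hasFiniteProducts_of_has_binary_and_terminal

lemma exists_pathObject (J : GrothendieckTopology E) (B : FibredCat.{w} E) :
    ∃ (P : FibredCat.{w} E) (s : B ⟶ P) (d : P ⟶ B ⨯ B),
      bicoverings J s ∧ isofibrations E d ∧ s ≫ d = diag B := by
  let i : pathSpace.square B ≅ B ⨯ B :=
    (isLimitStrictPullback B B).conePointUniqueUpToIso (limit.isLimit _)
  have h₁ : i.hom ≫ prod.fst = strictPullback.fst _ _ _ :=
    (isLimitStrictPullback B B).conePointUniqueUpToIso_hom_comp (limit.isLimit _) ⟨.left⟩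
  have h₂ : i.hom ≫ prod.snd = strictPullback.snd _ _ _ :=
    (isLimitStrictPullback B B).conePointUniqueUpToIso_hom_comp (limit.isLimit _) ⟨.right⟩
  refine ⟨pathSpace B, pathSpace.const B, pathSpace.endpoints B ≫ i.hom, ?_, ?_, ?_⟩
  · have := pathSpace.isEquivalence_const B
    exact bicoverings_of_isEquivalence J _
  · exact isofibrations_comp (pathSpace.isofibrations_endpoints B) (isofibrations_of_isIso _)
  · ext1
    · rw [Category.assoc, Category.assoc, h₁, prod.lift_fst]
      exact pathSpace.const_left B
    · rw [Category.assoc, Category.assoc, h₂, prod.lift_snd]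
      exact pathSpace.const_right B

/-! ### Stability under pullback -/

section Pullback

variable {J : GrothendieckTopology E} {P A B D : FibredCat.{w} E} {p₁ : P ⟶ A} {p₂ : P ⟶ B}
  {f : A ⟶ D} {g : B ⟶ D}

lemma bicoverings_of_isIso (u : A ⟶ B) [IsIso u] : bicoverings J u :=
  have := isEquivalence_of_isIso u
  bicoverings_of_isEquivalence J u

/-- Every pullback square is isomorphic to the strict one. -/
lemma isofibrations_of_isPullback (h : IsPullback p₁ p₂ f g) (hg : isofibrations E g) :
    isofibrations E p₁ := by
  rw [← h.isoIsPullback_hom_fst _ _ (strictPullback.isPullback hg)]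
  exact isofibrations_comp (isofibrations_of_isIso _) (strictPullback.isofibrations_fst hg)

lemma bicoverings_fst_of_isPullback (h : IsPullback p₁ p₂ f g) (hg : isofibrations E g)
    (hgJ : bicoverings J g) : bicoverings J p₁ := by
  rw [← h.isoIsPullback_hom_fst _ _ (strictPullback.isPullback hg)]
  exact (bicoverings_of_isIso _).comp (strictPullback.bicoverings_fst hg hgJ)

lemma bicoverings_snd_of_isPullback (h : IsPullback p₁ p₂ f g) (hg : isofibrations E g)
    (hf : bicoverings J f) : bicoverings J p₂ := by
  rw [← h.isoIsPullback_hom_snd _ _ (strictPullback.isPullback hg)]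
  exact (bicoverings_of_isIso _).comp (strictPullback.bicoverings_snd hg hf)

end Pullback

end FibredCat

theorem proposition40 {E : Type u} [Category.{v} E] (J : GrothendieckTopology E) :
    IsCategoryOfFibrantObjects (FibredCat.bicoverings.{w} J) (FibredCat.isofibrations.{w} E) ∧
    (∀ ⦃P F G H : FibredCat.{w} E⦄ ⦃v' : P ⟶ F⦄ ⦃u' : P ⟶ G⦄ ⦃u : F ⟶ H⦄ ⦃v : G ⟶ H⦄,
      IsPullback v' u' u v → FibredCat.isofibrations.{w} E v →
      FibredCat.bicoverings.{w} J u → FibredCat.bicoverings.{w} J u') := by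
  refine ⟨?_, fun P F G H v' u' u v h hv hu => FibredCat.bicoverings_snd_of_isPullback h hv hu⟩
  exact
    { twoOutOfThree := FibredCat.bicoverings_hasTwoOutOfThreeProperty
      iso_weakEquivalence := fun _ _ f _ => FibredCat.bicoverings_of_isIso f
      comp_fibration := fun _ _ _ _ _ => FibredCat.isofibrations_comp
      iso_fibration := fun _ _ f _ => FibredCat.isofibrations_of_isIso f
      hasPullback := fun _ _ _ f g hg =>
        (FibredCat.strictPullback.isPullback (f := f) hg).hasPullback
      pullback_fibration := fun _ _ _ _ _ _ _ _ => FibredCat.isofibrations_of_isPullback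
      pullback_trivialFibration := fun _ _ _ _ _ _ _ _ h hg hgJ =>
        ⟨FibredCat.isofibrations_of_isPullback h hg,
          FibredCat.bicoverings_fst_of_isPullback h hg hgJ⟩
      pathObject := FibredCat.exists_pathObject J
      fibrant := fun _ => FibredCat.isofibrations_of_isTerminal terminalIsTerminal _ }
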